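/- Let $R$ be a normal domain (an integrally closed integral domain) and let $\mathscr A$ be an $n$-dimensional $R$-algebra, i.e. an associative unital, not necessarily commutative $R$-algebra whose underlying $R$-module is finitely generated projective of constant rank $n$. Let $R_{\mathscr A}=\operatorname{Sym}_R(\mathscr A^\vee)$, with fraction field $K_{\mathscr A}$, and let $\alpha\in \mathscr A\otimes_R R_{\mathscr A}$ be the universal element (the image of $\mathrm{id}_{\mathscr A}\in\operatorname{End}_R(\mathscr A)\simeq\mathscr A\otimes_R\mathscr A^\vee$; if $e_1,\dots,e_n$ is a basis of $\mathscr A$ then $\alpha=\sum_i e_i^*e_i$). Let $d$ be the degree of algebraicity of $\mathscr A$, i.e. the least integer $d\ge 0$ such that $1\wedge\alpha\wedge\dots\wedge\alpha^{d}=0$ in $\wedge^{d+1}(\mathscr A\otimes_R R_{\mathscr A})$. Let $P$ be the monic polynomial of least degree in $R_{\mathscr A}[T]$ with $P(\alpha)=0$ (since $R$ is normal, it is the minimal polynomial of $\alpha$ over $K_{\mathscr A}$), and let the determinant of $\mathscr A$ be $$\det\nolimits_{\mathscr A/R}=(-1)^dP(0)\in R_{\mathscr A}.$$ Suppose that $\det_{\mathscr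 A/R}$ is an irreducible element of $R_{\mathscr A}$. Then $\det_{\mathscr A/R}$ is homogeneous of degree $d$, i.e. lies in $\operatorname{Sym}^d(\mathscr A^\vee)$, its degree $d$ divides $n$, and there is an integer $m\ge 0$ such that the Cayley–Hamilton polynomial of $\alpha$ (the characteristic polynomial of left multiplication by $\alpha$ on $\mathscr A\otimes_R K_{\mathscr A}$) is the $m$-th power of the minimal polynomial of $\alpha$ over $K_{\mathscr A}$. -/

import Mathlib

open scoped TensorProduct Polynomial

universe u v

noncomputable section

namespace AlgDet

/-- A symmetric algebra of a projective module over a domain is a domain. -/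
instance isDomain_symmetricAlgebra {R : Type u} {M : Type v} [CommRing R] [IsDomain R]
    [AddCommGroup M] [Module R M] [Module.Projective R M] :
    IsDomain (SymmetricAlgebra R M) := by
  obtain ⟨s, hs⟩ := Module.projective_def'.mp (inferInstance : Module.Projective R M)
  let p : (M →₀ R) →ₗ[R] M := Finsupp.linearCombination R id
  let f : SymmetricAlgebra R M →ₐ[R] SymmetricAlgebra R (M →₀ R) :=
    SymmetricAlgebra.lift (SymmetricAlgebra.ι R (M →₀ R) ∘ₗ s)
  let g : SymmetricAlgebra R (M →₀ R) →ₐ[R] SymmetricAlgebra R M :=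
    SymmetricAlgebra.lift (SymmetricAlgebra.ι R M ∘ₗ p)
  have hgf : g.comp f = AlgHom.id R _ := by
    apply SymmetricAlgebra.algHom_ext
    ext x
    have : p (s x) = x := LinearMap.congr_fun hs x
    simp [f, g, SymmetricAlgebra.lift_ι_apply, this]
  have hinj : Function.Injective f :=
    Function.LeftInverse.injective (g := g) fun x => AlgHom.congr_fun hgf x
  exact hinj.isDomain f.toRingHom

section

variable (R : Type u) (A : Type v) [CommRing R] [Ring A] [Algebra R A]

/-- The ring of functions `Sym(A^∨)` on the vector bundle attached to `A`. -/
abbrev FunctionRing : Type (max u v) := SymmetricAlgebra R (Module.Dual R A)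

/-- The homogeneous component `Sym^d(A^∨)`: the `R`-span of the products of `d` linear forms. -/
def homogeneousPart (d : ℕ) : Submodule R (FunctionRing R A) :=
  LinearMap.range (SymmetricAlgebra.ι R (Module.Dual R A)) ^ d

/-- The universal element `α ∈ Sym(A^∨) ⊗ A`: the image of the identity under
`End_R(A) ≃ A^∨ ⊗ A → Sym(A^∨) ⊗ A`. -/
def universalElement [Module.Finite R A] [Module.Projective R A] : FunctionRing R A ⊗[R] A :=
  (SymmetricAlgebra.ι R (Module.Dual R A)).rTensor A
    ((dualTensorHomEquiv R A A).symm LinearMap.id)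

/-- The degree of algebraicity: the least `d` such that
`1 ∧ α ∧ ⋯ ∧ α ^ d = 0` in the `(d + 1)`-st exterior power of `Sym(A^∨) ⊗ A`. -/
def algDegree [Module.Finite R A] [Module.Projective R A] : ℕ :=
  sInf {d : ℕ | exteriorPower.ιMulti (FunctionRing R A) (d + 1)
    (fun i : Fin (d + 1) => universalElement R A ^ (i : ℕ)) = 0}

/-- The determinant of `A`: up to the sign `(-1) ^ d`, the constant coefficient of
the minimal polynomial of the universal element. By `IsDeterminant.eq_det` below it is the only
possible element with the properties `IsDeterminant` that characterise the determinant. -/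
def det [Module.Finite R A] [Module.Projective R A] : FunctionRing R A :=
  (-1) ^ algDegree R A * (minpoly (FunctionRing R A) (universalElement R A)).coeff 0

variable {R A} in
/-- The value of functions on `A` at a point `x ∈ R' ⊗ A`; a linear form `φ` goes
to `(id ⊗ φ) x`. -/
def evalAt {R' : Type*} [CommRing R'] [Algebra R R'] (x : R' ⊗[R] A) :
    FunctionRing R A →ₐ[R] R' :=
  SymmetricAlgebra.lift
    ((TensorProduct.rid R R').toLinearMap ∘ₗ
      (LinearMap.lTensorHom (R := R) (N := A) (P := R) R').flip x)

variable {R A} in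
/-- The element `T - a` of `R'[T] ⊗ A`, for `a ∈ R' ⊗ A`. -/
def varSub {R' : Type*} [CommRing R'] [Algebra R R'] (a : R' ⊗[R] A) : R'[X] ⊗[R] A :=
  Polynomial.X ⊗ₜ[R] (1 : A) -
    Algebra.TensorProduct.map (Polynomial.CAlgHom (R := R) (A := R')) (AlgHom.id R A) a

/-- The properties that characterise the determinant: it is a form of degree `d`,
it is a morphism of unitary multiplicative monoids on points with values in every commutative
`R`-algebra, and every point `a` is annihilated by the polynomial `δ (T - a)`. -/
structure IsDeterminant [Module.Finite R A] [Module.Projective R A]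
    (δ : FunctionRing R A) : Prop where
  mem : δ ∈ homogeneousPart R A (algDegree R A)
  map_one : ∀ (R' : Type (max u v)) [CommRing R'] [Algebra R R'],
    evalAt (1 : R' ⊗[R] A) δ = 1
  map_mul : ∀ (R' : Type (max u v)) [CommRing R'] [Algebra R R'] (x y : R' ⊗[R] A),
    evalAt (x * y) δ = evalAt x δ * evalAt y δ
  aeval_eq_zero : ∀ (R' : Type (max u v)) [CommRing R'] [Algebra R R'] (a : R' ⊗[R] A),
    Polynomial.aeval a (evalAt (varSub a) δ) = 0

end

section

variable (R : Type u) (A : Type v) [CommRing R] [IsDomain R] [Ring A] [Algebra R A]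
  [Module.Finite R A] [Module.Projective R A]

/-- The fraction field of the function ring `Sym(A^∨)`. -/
abbrev FunctionField : Type (max u v) := FractionRing (FunctionRing R A)

/-- The universal element, viewed in the algebra `Frac(Sym(A^∨)) ⊗ A` over the function field. -/
def genericElement : FunctionField R A ⊗[R] A :=
  Algebra.TensorProduct.map (IsScalarTower.toAlgHom R (FunctionRing R A) (FunctionField R A))
    (AlgHom.id R A) (universalElement R A)

/-- The Cayley–Hamilton polynomial of the universal element: the characteristic polynomial of
the left multiplication by it on `Frac(Sym(A^∨)) ⊗ A`. -/
def cayleyHamilton : (FunctionField R A)[X] :=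
  haveI : Module.Free (FunctionField R A) (FunctionField R A ⊗[R] A) :=
    Module.Free.of_divisionRing (FunctionField R A) (FunctionField R A ⊗[R] A)
  (LinearMap.mulLeft (FunctionField R A) (genericElement R A)).charpoly

end

section

/-- Exterior powers of a projective module over a domain are torsion-free. -/
theorem isTorsionFree_exteriorPower {S M : Type*} [CommRing S] [IsDomain S] [AddCommGroup M]
    [Module S M] [Module.Projective S M] (k : ℕ) :
    Module.IsTorsionFree S (⋀[S]^k M) := by
  obtain ⟨s, hs⟩ := Module.projective_def'.mp (inferInstance : Module.Projective S M)
  exact (exteriorPower.map_injective (n := k) (f := s) _ hs).moduleIsTorsionFree _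
    (fun c x => map_smul (exteriorPower.map k s) c x)

variable {R : Type u} {A : Type v} [CommRing R] [Ring A] [Algebra R A]

theorem evalAt_ι {R' : Type*} [CommRing R'] [Algebra R R'] (x : R' ⊗[R] A)
    (φ : Module.Dual R A) :
    evalAt x (SymmetricAlgebra.ι R _ φ) = TensorProduct.rid R R' (φ.lTensor R' x) := by
  simp [evalAt, SymmetricAlgebra.lift_ι_apply]

theorem evalAt_universalElement [Module.Finite R A] [Module.Projective R A]
    (δ : FunctionRing R A) : evalAt (universalElement R A) δ = δ := by
  have key : ∀ (t : Module.Dual R A ⊗[R] A) (φ : Module.Dual R A),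
      TensorProduct.rid R _ (φ.lTensor _
        ((SymmetricAlgebra.ι R (Module.Dual R A)).rTensor A t)) =
      SymmetricAlgebra.ι R _ (φ ∘ₗ dualTensorHom R A A t) := by
    intro t φ
    induction t with
    | zero => simp
    | add x y hx hy => simp [hx, hy, LinearMap.comp_add]
    | tmul f a =>
      simp only [LinearMap.rTensor_tmul, LinearMap.lTensor_tmul, TensorProduct.rid_tmul]
      rw [← map_smul]
      congr 1
      ext b
      simp [mul_comm]
  have h : evalAt (universalElement R A) = AlgHom.id R (FunctionRing R A) := by
    apply SymmetricAlgebra.algHom_ext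
    ext φ
    change evalAt (universalElement R A) (SymmetricAlgebra.ι R _ φ) = SymmetricAlgebra.ι R _ φ
    rw [evalAt_ι, universalElement]
    erw [key]
    have : dualTensorHom R A A ((dualTensorHomEquiv R A A).symm LinearMap.id) = LinearMap.id :=
      (dualTensorHomEquiv R A A).apply_symm_apply LinearMap.id
    rw [this]
    rfl
  rw [h]; rfl

theorem evalAt_varSub_ι {R' : Type*} [CommRing R'] [Algebra R R'] (a : R' ⊗[R] A)
    (φ : Module.Dual R A) :
    evalAt (varSub a) (SymmetricAlgebra.ι R _ φ) =
      Polynomial.C (evalAt (1 : R' ⊗[R] A) (SymmetricAlgebra.ι R _ φ)) * Polynomial.X -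
        Polynomial.C (evalAt a (SymmetricAlgebra.ι R _ φ)) := by
  simp only [evalAt_ι, varSub, map_sub]
  congr 1
  · rw [Algebra.TensorProduct.one_def]
    simp [Algebra.smul_def]
  · induction a with
    | zero => simp
    | add x y hx hy => simp [hx, hy]
    | tmul r b =>
      simp [Algebra.smul_def]

/-- If `δ` is a form of degree `d`, then `δ (T - a)` has degree at most `d`, leading coefficient
`δ 1` and constant coefficient `(-1) ^ d * δ a`. -/
theorem evalAt_varSub {R' : Type*} [CommRing R'] [Algebra R R'] (a : R' ⊗[R] A) (d : ℕ)
    (δ : FunctionRing R A) (h : δ ∈ homogeneousPart R A d) :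
    (evalAt (varSub a) δ).natDegree ≤ d ∧
    (evalAt (varSub a) δ).coeff d = evalAt (1 : R' ⊗[R] A) δ ∧
    (evalAt (varSub a) δ).coeff 0 = (-1) ^ d * evalAt a δ := by
  unfold homogeneousPart at h
  induction h using Submodule.pow_induction_on_left' with
  | algebraMap r => simp [Polynomial.algebraMap_apply]
  | add x y i hx hy ihx ihy =>
    refine ⟨?_, ?_, ?_⟩
    · rw [map_add]
      exact Polynomial.natDegree_add_le_of_degree_le ihx.1 ihy.1
    · simp [ihx.2.1, ihy.2.1]
    · simp [ihx.2.2, ihy.2.2, mul_add]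
  | mem_mul m hm i x hx ih =>
    obtain ⟨φ, rfl⟩ := hm
    have hl : (evalAt (varSub a) (SymmetricAlgebra.ι R _ φ)).natDegree ≤ 1 := by
      rw [evalAt_varSub_ι]
      compute_degree
    refine ⟨?_, ?_, ?_⟩
    · rw [map_mul, Nat.succ_eq_one_add]
      exact Polynomial.natDegree_mul_le_of_le hl ih.1
    · rw [map_mul, map_mul, Nat.succ_eq_one_add, Polynomial.coeff_mul_add_eq_of_natDegree_le hl ih.1, ih.2.1,
        evalAt_varSub_ι]
      simp
    · rw [map_mul, map_mul, Polynomial.mul_coeff_zero, ih.2.2, evalAt_varSub_ι]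
      simp
      ring

theorem algDegree_le_natDegree [IsDomain R] [Module.Finite R A] [Module.Projective R A]
    (p : (FunctionRing R A)[X]) (hp : p ≠ 0)
    (h : Polynomial.aeval (universalElement R A) p = 0) : algDegree R A ≤ p.natDegree := by
  apply Nat.sInf_le
  rw [Set.mem_ofPred_eq]
  have := isTorsionFree_exteriorPower (S := FunctionRing R A) (M := FunctionRing R A ⊗[R] A)
    (p.natDegree + 1)
  apply AlternatingMap.map_linearDependent
  intro hli
  rw [Fintype.linearIndependent_iff] at hli
  have := hli (fun i => p.coeff i) (by
    rw [Polynomial.aeval_eq_sum_range, Finset.sum_range] at h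
    exact h) (Fin.last _)
  simp at this
  exact hp this

/-- Over a domain, an element with the properties that characterise the determinant
is `det R A`. -/
theorem IsDeterminant.eq_det [IsDomain R] [Module.Finite R A] [Module.Projective R A]
    {δ : FunctionRing R A} (h : IsDeterminant R A δ) :
    δ = det R A ∧
      evalAt (varSub (universalElement R A)) δ =
        minpoly (FunctionRing R A) (universalElement R A) := by
  obtain ⟨h1, h2, h3⟩ := evalAt_varSub (universalElement R A) _ δ h.mem
  rw [h.map_one] at h2
  rw [evalAt_universalElement] at h3
  have h0 := h.aeval_eq_zero _ (universalElement R A)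
  set Q := evalAt (varSub (universalElement R A)) δ with hQ
  have hmon : Q.Monic := Polynomial.monic_of_natDegree_le_of_coeff_eq_one _ h1 h2
  have hint : IsIntegral (FunctionRing R A) (universalElement R A) := ⟨Q, hmon, h0⟩
  have hP := minpoly.monic hint
  have hPle := Polynomial.natDegree_le_natDegree (minpoly.min _ _ hmon h0)
  have hPge := algDegree_le_natDegree _ hP.ne_zero (minpoly.aeval _ _)
  have hQP : Q = minpoly (FunctionRing R A) (universalElement R A) := by
    by_contra hne
    have hlt : (Q - minpoly (FunctionRing R A) (universalElement R A)).degree < Q.degree := by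
      apply Polynomial.degree_sub_lt_left
      · rw [Polynomial.degree_eq_natDegree hmon.ne_zero, Polynomial.degree_eq_natDegree hP.ne_zero]
        congr 1; omega
      · exact hmon.ne_zero
      · rw [hmon, hP]
    have := algDegree_le_natDegree _ (sub_ne_zero.mpr hne) (by rw [map_sub, h0, minpoly.aeval, sub_zero])
    have := Polynomial.natDegree_lt_natDegree (sub_ne_zero.mpr hne) hlt
    omega
  refine ⟨?_, hQP⟩
  rw [det, ← hQP, h3, ← mul_assoc, ← mul_pow]
  simp

end

end AlgDet

end

/-!
Write `S = Sym(A^∨)`, `K = Frac S`, let `α` be the universal element and `P` its minimal polynomial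
over `S`.

The ring `S` is a retract of a polynomial ring over `R`, hence normal
(`isIntegrallyClosed_symmetricAlgebra`). By Gauss's lemma `P` is then also the minimal polynomial
of `α` over `K` (`map_minpoly_universalElement`), and its degree is the degree of algebraicity `d`
(`algDegree_eq_natDegree_minpoly`): over a field a vanishing wedge product means linear dependence.

Multiplying all linear forms by a parameter `t` takes `α` to `t α`. Hence scaling both the linear
forms and the variable `T` by `t` takes `P` to a polynomial in `t` all of whose coefficients
annihilate `α` and have degree at most `d` in `T`; by minimality they are multiples of `P`, and the
leading coefficient shows that `P` is taken to `t ^ d P` (`scalePoly_eq_of_minimal`). So `P` is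
homogeneous of total degree `d`, and its constant coefficient is a form of degree `d`.

If `P = F G` with `F`, `G` monic, then `F` and `G` are homogeneous too, since the factors of a
monomial in `t` are monomials. When the determinant is irreducible, one of `F(0)`, `G(0)` is a
unit, hence of degree `0`, and the corresponding factor is `1`. So `P` is irreducible
(`irreducible_of_irreducible_coeff_zero`), and also over `K` by Gauss's lemma. The characteristic
polynomial of an endomorphism divides a power of any polynomial annihilating it, so here it is
`P ^ m` (`exists_charpoly_mulLeft_eq_minpoly_pow`), and comparing degrees gives `n = m d`.
-/

noncomputable section

namespace AlgDet

open Polynomial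

/-! ### Normality of symmetric algebras -/

/-- A retract of an integrally closed domain is integrally closed. -/
theorem isIntegrallyClosed_of_retract {S T : Type*} [CommRing S] [IsDomain S] [CommRing T]
    [IsDomain T] [IsIntegrallyClosed T] (f : S →+* T) (g : T →+* S) (hgf : ∀ s, g (f s) = s) :
    IsIntegrallyClosed S := by
  have hf : Function.Injective f := Function.LeftInverse.injective hgf
  refine (isIntegrallyClosed_iff (FractionRing S)).mpr fun {x} hx => ?_
  obtain ⟨a, b, hb, rfl⟩ := IsFractionRing.div_surjective (A := S) x
  have hx' := hx.map_of_comp_eq f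
    (IsFractionRing.map (K := FractionRing S) (L := FractionRing T) hf)
    (by ext; simp [IsFractionRing.map])
  obtain ⟨t, ht⟩ := IsIntegrallyClosed.isIntegral_iff.mp hx'
  have hb0 : b ≠ 0 := nonZeroDivisors.ne_zero hb
  have hfb : algebraMap T (FractionRing T) (f b) ≠ 0 := by
    simpa [map_eq_zero_iff f hf] using hb0
  have htb : t * f b = f a := by
    apply IsFractionRing.injective T (FractionRing T)
    rw [map_mul, ht]
    simp only [map_div₀, IsFractionRing.map, IsLocalization.map_eq]
    exact div_mul_cancel₀ _ hfb
  refine ⟨g t, ?_⟩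
  have hgt : g t * b = a := by rw [← hgf b, ← map_mul, htb, hgf]
  rw [eq_div_iff (by simpa using hb0), ← map_mul, hgt]

theorem isIntegrallyClosed_mvPolynomial_fin {R : Type*} [CommRing R] [IsDomain R]
    [IsIntegrallyClosed R] (n : ℕ) : IsIntegrallyClosed (MvPolynomial (Fin n) R) := by
  induction n with
  | zero => exact .of_equiv (MvPolynomial.isEmptyAlgEquiv R (Fin 0)).symm.toRingEquiv
  | succ n ih => exact .of_equiv (MvPolynomial.finSuccEquiv R n).symm.toRingEquiv

/-- The symmetric algebra of a finitely generated projective module over a normal domain is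
normal, being a retract of a polynomial ring. -/
theorem isIntegrallyClosed_symmetricAlgebra {R M : Type*} [CommRing R] [IsDomain R]
    [IsIntegrallyClosed R] [AddCommGroup M] [Module R M] [Module.Finite R M]
    [Module.Projective R M] : IsIntegrallyClosed (SymmetricAlgebra R M) := by
  obtain ⟨n, p, s, -, -, hps⟩ := Module.Finite.exists_comp_eq_id_of_projective R M
  have := isIntegrallyClosed_mvPolynomial_fin (R := R) n
  have : IsIntegrallyClosed (SymmetricAlgebra R (Fin n → R)) :=
    .of_equiv (SymmetricAlgebra.equivMvPolynomial (Pi.basisFun R (Fin n))).symm.toRingEquiv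
  let f : SymmetricAlgebra R M →ₐ[R] SymmetricAlgebra R (Fin n → R) :=
    SymmetricAlgebra.lift (SymmetricAlgebra.ι R (Fin n → R) ∘ₗ s)
  let g : SymmetricAlgebra R (Fin n → R) →ₐ[R] SymmetricAlgebra R M :=
    SymmetricAlgebra.lift (SymmetricAlgebra.ι R M ∘ₗ p)
  have hgf : g.comp f = AlgHom.id R _ := by
    apply SymmetricAlgebra.algHom_ext
    ext x
    have : p (s x) = x := LinearMap.congr_fun hps x
    simp [f, g, SymmetricAlgebra.lift_ι_apply, this]
  exact isIntegrallyClosed_of_retract f.toRingHom g.toRingHom fun x => AlgHom.congr_fun hgf x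

/-! ### Factors of monomials and characteristic polynomials -/

/-- A factor of `c * X ^ d` with `c ≠ 0`, over a domain, is a monomial; its coefficient is its
value at `1`. -/
theorem exists_eq_X_pow_mul_C_of_mul_eq {D : Type*} [CommRing D] [IsDomain D] {F G : D[X]} {c : D}
    (hc : c ≠ 0) {d : ℕ} (h : F * G = X ^ d * C c) : ∃ a, F = X ^ a * C (F.eval 1) := by
  have hne : F * G ≠ 0 := by
    rw [h]
    exact mul_ne_zero (pow_ne_zero _ X_ne_zero) (C_ne_zero.mpr hc)
  have hF := left_ne_zero_of_mul hne
  have hG := right_ne_zero_of_mul hne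
  have h1 := natDegree_mul hF hG
  have h2 := natTrailingDegree_mul hF hG
  have hm : X ^ d * C c = monomial d c := by rw [mul_comm, C_mul_X_pow_eq_monomial]
  rw [h, hm] at h1 h2
  rw [natDegree_monomial_eq _ hc] at h1
  rw [natTrailingDegree_monomial hc] at h2
  have h3 := natTrailingDegree_le_natDegree F
  have h4 := natTrailingDegree_le_natDegree G
  have hmon : F = X ^ F.natDegree * C F.leadingCoeff := by
    ext k
    rw [coeff_X_pow_mul', coeff_C]
    rcases lt_trichotomy k F.natDegree with hk | rfl | hk
    · rw [if_neg (by omega)]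
      exact coeff_eq_zero_of_lt_natTrailingDegree (by omega)
    · simp
    · rw [if_pos hk.le, if_neg (by omega)]
      exact coeff_eq_zero_of_natDegree_lt hk
  refine ⟨F.natDegree, ?_⟩
  have he : F.eval 1 = F.leadingCoeff := by rw [hmon]; simp
  rw [he]
  exact hmon

/-- If a polynomial `p` annihilates a matrix, the characteristic polynomial of the matrix divides a
power of `p`: take determinants in `p(T) - p(M) = (T - M) N`. -/
theorem charpoly_dvd_pow_of_aeval_eq_zero {R ι : Type*} [CommRing R] [Fintype ι] [DecidableEq ι]
    (M : Matrix ι ι R) (p : R[X]) (hp : aeval M p = 0) :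
    M.charpoly ∣ p ^ Fintype.card ι := by
  let φ : Matrix ι ι R →ₐ[R] Matrix ι ι R[X] := (CAlgHom (R := R) (A := R)).mapMatrix
  -- `q` is the polynomial in two variables with `p(Y) - p(T) = (Y - T) q(T, Y)`.
  obtain ⟨q, hq⟩ := X_sub_C_dvd_sub_C_eval (a := (X : R[X])) (p := p.map (algebraMap R R[X]))
  have hM : aeval (φ M) (p.map (algebraMap R R[X])) = 0 := by
    rw [aeval_map_algebraMap, aeval_algHom_apply, hp, map_zero]
  have h := congrArg (aeval (φ M)) hq
  rw [eval_map_algebraMap, aeval_X_left_apply, map_sub, hM, zero_sub, aeval_C, map_mul, map_sub,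
    aeval_X, aeval_C] at h
  have hchar : M.charmatrix = algebraMap R[X] _ X - φ M := rfl
  have h' : M.charmatrix * aeval (φ M) q = algebraMap R[X] _ p := by
    rw [hchar, ← neg_sub, neg_mul, ← h, neg_neg]
  have hdet := congrArg Matrix.det h'
  rw [Matrix.det_mul, Algebra.algebraMap_eq_smul_one, Matrix.det_smul, Matrix.det_one,
    mul_one] at hdet
  exact ⟨_, hdet.symm⟩

theorem linearMap_charpoly_dvd_pow {K V : Type*} [Field K] [AddCommGroup V] [Module K V]
    [Module.Finite K V] (f : Module.End K V) (p : K[X]) (hp : aeval f p = 0) :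
    f.charpoly ∣ p ^ Module.finrank K V := by
  let b := Module.finBasis K V
  have := charpoly_dvd_pow_of_aeval_eq_zero (LinearMap.toMatrixAlgEquiv b f) p (by
    rw [aeval_algHom_apply (LinearMap.toMatrixAlgEquiv b), hp, map_zero])
  rwa [Fintype.card_fin, show (LinearMap.toMatrixAlgEquiv b f).charpoly = f.charpoly from
    LinearMap.charpoly_toMatrix f b] at this

/-- If the minimal polynomial of `b` is irreducible, the characteristic polynomial of the left
multiplication by `b` is a power of it; comparing degrees gives the exponent. -/
theorem exists_charpoly_mulLeft_eq_minpoly_pow {K B : Type*} [Field K] [Ring B] [Algebra K B]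
    [Module.Finite K B] (b : B) (hirr : Irreducible (minpoly K b)) :
    ∃ m : ℕ, (LinearMap.mulLeft K b).charpoly = minpoly K b ^ m ∧
      Module.finrank K B = m * (minpoly K b).natDegree := by
  have hb : aeval (LinearMap.mulLeft K b) (minpoly K b) = 0 := by
    rw [show LinearMap.mulLeft K b = Algebra.lmul K B b from rfl, aeval_algHom_apply,
      minpoly.aeval, map_zero]
  obtain ⟨m, -, hm⟩ := (dvd_prime_pow hirr.prime _).mp
    (linearMap_charpoly_dvd_pow (LinearMap.mulLeft K b) _ hb)
  have hmon : (minpoly K b).Monic := minpoly.monic (.of_finite K b)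
  have hpow := eq_of_monic_of_associated (LinearMap.charpoly_monic _) (hmon.pow m) hm
  refine ⟨m, hpow, ?_⟩
  rw [← LinearMap.charpoly_natDegree (LinearMap.mulLeft K b), hpow, hmon.natDegree_pow]

theorem finrank_tensorProduct_of_rankAtStalk_eq {R K A : Type*} [CommRing R] [Field K]
    [Algebra R K] [AddCommGroup A] [Module R A] [Module.Finite R A] [Module.Projective R A] (n : ℕ)
    (hn : ∀ p : PrimeSpectrum R, Module.rankAtStalk (R := R) A p = n) :
    Module.finrank K (K ⊗[R] A) = n := by
  have h := Module.rankAtStalk_baseChange (R := R) (M := A) (S := K) ⊥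
  rwa [hn, Module.rankAtStalk_eq_finrank_of_free] at h

/-! ### Vanishing wedge products -/

/-- Vectors whose wedge product vanishes become linearly dependent under every linear map to a
vector space. -/
theorem not_linearIndependent_of_ιMulti_eq_zero {S K M E : Type*} [CommRing S] [Field K]
    [Algebra S K] [AddCommGroup M] [Module S M] [AddCommGroup E] [Module S E] [Module K E]
    [IsScalarTower S K E] (j : M →ₗ[S] E) {k : ℕ} (v : Fin k → M)
    (hv : exteriorPower.ιMulti S k v = 0) : ¬ LinearIndependent K (fun i => j (v i)) := by
  intro hli
  -- A linear map `f` sending the vectors to the standard basis pulls back the determinant form.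
  obtain ⟨f, hf⟩ := (Finsupp.linearCombination K fun i => j (v i)).exists_leftInverse_of_injective
    (by rwa [LinearMap.ker_eq_bot])
  let D : E [⋀^Fin k]→ₗ[K] K :=
    (Matrix.detRowAlternating (n := Fin k) (R := K)).compLinearMap
      ((Finsupp.linearEquivFunOnFinite K K (Fin k)).toLinearMap ∘ₗ f)
  let D' : M [⋀^Fin k]→ₗ[S] K :=
    AlternatingMap.compLinearMap { (D.toMultilinearMap.restrictScalars S) with
    map_eq_zero_of_eq' := D.map_eq_zero_of_eq' } j
  have h0 : D' v = 0 := by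
    rw [← exteriorPower.alternatingMapLinearEquiv_apply_ιMulti D' v, hv, map_zero]
  have hfv : ∀ i, f (j (v i)) = Finsupp.single i 1 := fun i => by
    simpa using LinearMap.congr_fun hf (Finsupp.single i 1)
  have h1 : D' v = 1 := by
    change Matrix.det (fun i => ((Finsupp.linearEquivFunOnFinite K K (Fin k)) (f (j (v i))))) = 1
    rw [← Matrix.det_one (n := Fin k)]
    congr 1
    ext i i'
    simp [hfv, Matrix.one_apply, Finsupp.single_apply]
  exact one_ne_zero (h1.symm.trans h0)

theorem natDegree_minpoly_le_of_ιMulti_pow_eq_zero {S K B E : Type*} [CommRing S] [Field K]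
    [Algebra S K] [Ring B] [Algebra S B] [Ring E] [Algebra S E] [Algebra K E] [IsScalarTower S K E]
    (j : B →ₐ[S] E) (b : B) {d : ℕ}
    (h : exteriorPower.ιMulti S (d + 1) (fun i : Fin (d + 1) => b ^ (i : ℕ)) = 0) :
    (minpoly K (j b)).natDegree ≤ d := by
  by_contra hlt
  refine not_linearIndependent_of_ιMulti_eq_zero (K := K) j.toLinearMap _ h ?_
  have hli := (linearIndependent_pow (K := K) (j b)).comp
    (Fin.castLE (by omega : d + 1 ≤ (minpoly K (j b)).natDegree)) (Fin.castLE_injective _)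
  have hfun : (fun i : Fin (d + 1) => j.toLinearMap (b ^ (i : ℕ))) =
      (fun i : Fin (minpoly K (j b)).natDegree => j b ^ (i : ℕ)) ∘ Fin.castLE (by omega) := by
    ext i
    simp
  rw [hfun]
  exact hli

/-! ### Homogeneity by scaling -/

section Scaling

variable {R : Type*} {M : Type*} [CommRing R] [AddCommGroup M] [Module R M]

/-- The homomorphism `Sym(M) → Sym(M)[t]` that multiplies every linear form by `t`; it multiplies
the forms of degree `d` by `t ^ d`. -/
def scale : SymmetricAlgebra R M →ₐ[R] (SymmetricAlgebra R M)[X] :=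
  SymmetricAlgebra.lift
    (LinearMap.mulLeft R (X : (SymmetricAlgebra R M)[X]) ∘ₗ
      (CAlgHom (R := R) (A := SymmetricAlgebra R M)).toLinearMap ∘ₗ SymmetricAlgebra.ι R M)

@[simp]
theorem scale_ι (m : M) :
    scale (SymmetricAlgebra.ι R M m) = X * C (SymmetricAlgebra.ι R M m) := by
  simp [scale, SymmetricAlgebra.lift_ι_apply]

theorem eval_one_scale (x : SymmetricAlgebra R M) : (scale x).eval 1 = x := by
  induction x using SymmetricAlgebra.induction with
  | algebraMap r => simp [Polynomial.algebraMap_apply]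
  | ι m => simp
  | mul x y hx hy => simp [hx, hy]
  | add x y hx hy => simp [hx, hy]

theorem coeff_scale_mem (x : SymmetricAlgebra R M) (k : ℕ) :
    (scale x).coeff k ∈ LinearMap.range (SymmetricAlgebra.ι R M) ^ k := by
  induction x using SymmetricAlgebra.induction generalizing k with
  | algebraMap r =>
    rw [AlgHom.commutes, Polynomial.algebraMap_apply, coeff_C]
    split_ifs with h
    · subst h
      simp
    · exact zero_mem _
  | ι m =>
    rw [scale_ι, X_mul_C, coeff_C_mul, coeff_X]
    split_ifs with h
    · subst h
      simp
    · simp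
  | mul x y hx hy =>
    rw [map_mul, coeff_mul]
    refine Submodule.sum_mem _ fun ij hij => ?_
    rw [← Finset.HasAntidiagonal.mem_antidiagonal.mp hij, pow_add]
    exact Submodule.mul_mem_mul (hx _) (hy _)
  | add x y hx hy =>
    rw [map_add, coeff_add]
    exact add_mem (hx k) (hy k)

theorem mem_range_pow_of_scale_eq {x : SymmetricAlgebra R M} {d : ℕ}
    (h : scale x = X ^ d * C x) : x ∈ LinearMap.range (SymmetricAlgebra.ι R M) ^ d := by
  have := coeff_scale_mem x d
  rwa [h, coeff_X_pow_mul', if_pos le_rfl, Nat.sub_self, coeff_C_zero] at this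

/-- The extension of `scale` to a homomorphism `Sym(M)[T] → Sym(M)[T][t]` that also multiplies the
variable `T` by `t`. The scaling parameter `t` is the outer variable. -/
def scalePoly : (SymmetricAlgebra R M)[X] →+* (SymmetricAlgebra R M)[X][X] :=
  eval₂RingHom (S := (SymmetricAlgebra R M)[X][X])
    ((mapRingHom C).comp (scale (R := R) (M := M)).toRingHom) (X * C X)

theorem scalePoly_C (x : SymmetricAlgebra R M) : scalePoly (C x) = (scale x).map C := by
  simp [scalePoly]

theorem scalePoly_X : scalePoly (R := R) (M := M) X = X * C X := by
  simp [scalePoly]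

theorem scalePoly_C_mul_X_pow (x : SymmetricAlgebra R M) (j : ℕ) :
    scalePoly (C x * X ^ j) = (scale x * X ^ j).map C * C (X ^ j) := by
  rw [map_mul, map_pow, scalePoly_C, scalePoly_X, (commute_X (C X)).mul_pow, Polynomial.map_mul,
    Polynomial.map_pow, map_X, C_pow, mul_assoc]

theorem eval_one_scalePoly (p : (SymmetricAlgebra R M)[X]) : (scalePoly p).eval 1 = p := by
  have : (evalRingHom 1).comp (scalePoly (R := R) (M := M)) = RingHom.id _ := by
    refine Polynomial.ringHom_ext (fun x => ?_) ?_
    · simp only [RingHom.comp_apply, scalePoly_C, coe_evalRingHom, RingHom.id_apply]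
      rw [← map_one C, eval_map, eval₂_at_apply, eval_one_scale]
    · simp [scalePoly_X]
  exact RingHom.congr_fun this p

theorem coeff_coeff_scalePoly (p : (SymmetricAlgebra R M)[X]) (k j : ℕ) :
    ((scalePoly p).coeff k).coeff j = (scale (p.coeff j) * X ^ j).coeff k := by
  induction p using Polynomial.induction_on' with
  | add p q hp hq => simp only [map_add, coeff_add, add_mul, hp, hq]
  | monomial i a =>
    rw [← C_mul_X_pow_eq_monomial, scalePoly_C_mul_X_pow, coeff_mul_C, coeff_map, coeff_C_mul,
      coeff_C_mul, coeff_X_pow]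
    split_ifs with h
    · subst h
      simp
    · simp

end Scaling

/-! ### The minimal polynomial of the universal element -/

section Universal

variable {R : Type u} {A : Type v} [CommRing R] [Ring A] [Algebra R A]

variable (R A) in
/-- The inclusion of `Sym(A^∨) ⊗ A` as the constants of `Sym(A^∨)[t] ⊗ A`. -/
def constMap : FunctionRing R A ⊗[R] A →ₐ[R] (FunctionRing R A)[X] ⊗[R] A :=
  Algebra.TensorProduct.map (CAlgHom (R := R) (A := FunctionRing R A)) (AlgHom.id R A)

variable (R A) in
/-- The coefficient of `t ^ k`, as a map `Sym(A^∨)[t] ⊗ A → Sym(A^∨) ⊗ A`. -/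
def coeffMap (k : ℕ) : (FunctionRing R A)[X] ⊗[R] A →ₗ[R] FunctionRing R A ⊗[R] A :=
  ((lcoeff (FunctionRing R A) k).restrictScalars R).rTensor A

theorem coeffMap_tmul_one_mul_constMap (k : ℕ) (p : (FunctionRing R A)[X])
    (b : FunctionRing R A ⊗[R] A) :
    coeffMap R A k (p ⊗ₜ 1 * constMap R A b) = p.coeff k • b := by
  induction b with
  | zero => simp
  | add x y hx hy => simp only [map_add, mul_add, hx, hy, smul_add]
  | tmul s a => simp [coeffMap, constMap, TensorProduct.smul_tmul']

theorem map_scale_universalElement [Module.Finite R A] [Module.Projective R A] :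
    Algebra.TensorProduct.map (scale (R := R) (M := Module.Dual R A)) (AlgHom.id R A)
        (universalElement R A) =
      (X : (FunctionRing R A)[X]) ⊗ₜ[R] (1 : A) * constMap R A (universalElement R A) := by
  have key : ∀ t : Module.Dual R A ⊗[R] A,
      Algebra.TensorProduct.map (scale (R := R) (M := Module.Dual R A)) (AlgHom.id R A)
          ((SymmetricAlgebra.ι R (Module.Dual R A)).rTensor A t) =
        (X : (FunctionRing R A)[X]) ⊗ₜ[R] (1 : A) *
          constMap R A ((SymmetricAlgebra.ι R (Module.Dual R A)).rTensor A t) := by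
    intro t
    induction t with
    | zero => simp
    | add x y hx hy => simp only [map_add, mul_add, hx, hy]
    | tmul φ a => simp [constMap]
  exact key _

/-- Scaling takes `p(α)` to the value of the scaled polynomial at `α`, coefficient by
coefficient in `t`. -/
theorem aeval_coeff_scalePoly [Module.Finite R A] [Module.Projective R A]
    (p : (FunctionRing R A)[X]) (k : ℕ) :
    aeval (universalElement R A) ((scalePoly p).coeff k) =
      coeffMap R A k (Algebra.TensorProduct.map (scale (R := R) (M := Module.Dual R A))
        (AlgHom.id R A) (aeval (universalElement R A) p)) := by
  induction p using Polynomial.induction_on' with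
  | add p q hp hq => simp only [map_add, coeff_add, hp, hq]
  | monomial j s =>
    rw [← C_mul_X_pow_eq_monomial, scalePoly_C_mul_X_pow, coeff_mul_C, coeff_map]
    simp only [map_mul, aeval_C, map_pow, aeval_X, map_scale_universalElement]
    have hcomm : Commute ((X : (FunctionRing R A)[X]) ⊗ₜ[R] (1 : A))
        (constMap R A (universalElement R A)) := by
      rw [← mul_one X, ← smul_eq_mul, ← TensorProduct.smul_tmul', ← Algebra.TensorProduct.one_def]
      exact (Commute.one_left _).smul_left _
    rw [hcomm.mul_pow, ← map_pow, ← mul_assoc, Algebra.TensorProduct.algebraMap_apply,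
      Algebra.algebraMap_self_apply,
      show (Algebra.TensorProduct.map (scale (R := R) (M := Module.Dual R A)) (AlgHom.id R A))
        (algebraMap _ _ s) = scale s ⊗ₜ[R] (1 : A) from rfl,
      Algebra.TensorProduct.tmul_pow, one_pow, Algebra.TensorProduct.tmul_mul_tmul, mul_one,
      coeffMap_tmul_one_mul_constMap]
    exact (Algebra.smul_def ((scale s * X ^ j).coeff k) (universalElement R A ^ j)).symm

/-- A monic polynomial that annihilates the universal element and has the least degree among the
nonzero ones is homogeneous for the total degree: scaling it yields annihilating polynomials of no
larger degree, hence multiples of it. -/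
theorem scalePoly_eq_of_minimal [Module.Finite R A] [Module.Projective R A]
    {P : (FunctionRing R A)[X]} (hP : P.Monic) (h0 : aeval (universalElement R A) P = 0)
    (hmin : ∀ q : (FunctionRing R A)[X], q.degree < P.degree →
      aeval (universalElement R A) q = 0 → q = 0) :
    scalePoly P = X ^ P.natDegree * C P := by
  nontriviality FunctionRing R A
  ext1 k
  have hk : aeval (universalElement R A) ((scalePoly P).coeff k) = 0 := by
    rw [aeval_coeff_scalePoly, h0, map_zero, map_zero]
  have hdeg : ((scalePoly P).coeff k).degree ≤ P.natDegree := by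
    refine degree_le_iff_coeff_zero _ _ |>.mpr fun j hj => ?_
    rw [coeff_coeff_scalePoly, coeff_eq_zero_of_natDegree_lt (p := P) (by exact_mod_cast hj),
      map_zero, zero_mul, coeff_zero]
  set c := ((scalePoly P).coeff k).coeff P.natDegree with hc
  have hc' : c = if k = P.natDegree then 1 else 0 := by
    rw [hc, coeff_coeff_scalePoly, hP.coeff_natDegree, map_one, one_mul, coeff_X_pow]
  have hz : (scalePoly P).coeff k - C c * P = 0 := by
    refine hmin _ ?_ (by rw [map_sub, map_mul, hk, h0, mul_zero, sub_zero])
    rw [degree_eq_natDegree hP.ne_zero, degree_lt_iff_coeff_zero]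
    intro j hj
    rw [coeff_sub, coeff_C_mul]
    rcases hj.eq_or_lt with rfl | hj
    · rw [hP.coeff_natDegree, mul_one, sub_self]
    · rw [coeff_eq_zero_of_natDegree_lt hj, mul_zero, sub_zero]
      exact (degree_le_iff_coeff_zero _ _).mp hdeg j (by exact_mod_cast hj)
  rw [sub_eq_zero.mp hz, hc', coeff_X_pow_mul', coeff_C]
  rcases lt_trichotomy k P.natDegree with h | h | h
  · simp [h.ne, h.not_ge]
  · simp [h]
  · rw [if_neg h.ne', if_pos h.le, if_neg (by omega)]
    simp

end Universal

section Homogeneous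

variable {R : Type*} {M : Type*} [CommRing R] [AddCommGroup M] [Module R M]

theorem scale_coeff_zero_of_scalePoly_eq {P F : (SymmetricAlgebra R M)[X]} {a : ℕ}
    (h : scalePoly P = X ^ a * C F) : scale (P.coeff 0) = X ^ a * C (F.coeff 0) := by
  ext1 k
  have h' := coeff_coeff_scalePoly P k 0
  rw [pow_zero, mul_one] at h'
  rw [← h', h, coeff_X_pow_mul', coeff_X_pow_mul', coeff_C, coeff_C]
  split_ifs <;> simp

/-- A homogeneous monic polynomial of degree `f` over a symmetric algebra has a constant
coefficient of degree `f`; if it is a unit, then `f = 0`. -/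
theorem eq_one_of_isUnit_coeff_zero [IsDomain (SymmetricAlgebra R M)]
    {F : (SymmetricAlgebra R M)[X]} (hF : F.Monic) {a : ℕ} (h : scalePoly F = X ^ a * C F)
    (hu : IsUnit (F.coeff 0)) : F = 1 := by
  have h0 : IsUnit (X ^ a * C (F.coeff 0)) :=
    scale_coeff_zero_of_scalePoly_eq h ▸ hu.map (scale (R := R) (M := M))
  have ha : a = 0 := by
    by_contra ha
    exact not_isUnit_X ((isUnit_pow_iff ha).mp (isUnit_of_mul_isUnit_left h0))
  have h1 := coeff_coeff_scalePoly F F.natDegree F.natDegree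
  rw [h, ha, pow_zero, one_mul, hF.coeff_natDegree, map_one, one_mul, coeff_X_pow_self,
    coeff_C] at h1
  have hd : F.natDegree = 0 := by
    by_contra hd
    simp [hd] at h1
  exact hF.natDegree_eq_zero.mp hd

/-- A homogeneous monic polynomial whose constant coefficient is irreducible is irreducible: its
monic factors are homogeneous, and one of them has a unit as constant coefficient. -/
theorem irreducible_of_irreducible_coeff_zero [IsDomain (SymmetricAlgebra R M)]
    {P : (SymmetricAlgebra R M)[X]} (hP : P.Monic) {d : ℕ} (h : scalePoly P = X ^ d * C P)
    (hirr : Irreducible (P.coeff 0)) : Irreducible P := by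
  have hhom : ∀ F G : (SymmetricAlgebra R M)[X], F * G = P →
      ∃ a, scalePoly F = X ^ a * C F := by
    intro F G hFG
    obtain ⟨a, ha⟩ := exists_eq_X_pow_mul_C_of_mul_eq (F := scalePoly F) (G := scalePoly G)
      hP.ne_zero (by rw [← map_mul, hFG, h])
    rw [eval_one_scalePoly] at ha
    exact ⟨a, ha⟩
  rw [irreducible_of_monic hP (by rintro rfl; simp at hirr)]
  intro F G hF hG hFG
  rw [← hFG, mul_coeff_zero] at hirr
  rcases hirr.isUnit_or_isUnit rfl with hu | hu
  · obtain ⟨a, ha⟩ := hhom F G hFG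
    exact .inl (eq_one_of_isUnit_coeff_zero hF ha hu)
  · obtain ⟨a, ha⟩ := hhom G F (mul_comm F G ▸ hFG)
    exact .inr (eq_one_of_isUnit_coeff_zero hG ha hu)

end Homogeneous

/-! ### Passage to the function field -/

section Generic

variable (R : Type u) (A : Type v) [CommRing R] [Ring A] [Algebra R A]

/-- The embedding of `Sym(A^∨) ⊗ A` into `Frac(Sym(A^∨)) ⊗ A`. -/
def toGeneric : FunctionRing R A ⊗[R] A →ₐ[FunctionRing R A] FunctionField R A ⊗[R] A :=
  Algebra.TensorProduct.map (Algebra.ofId (FunctionRing R A) (FunctionField R A)) (AlgHom.id R A)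

theorem toGeneric_injective [Module.Projective R A] : Function.Injective (toGeneric R A) :=
  Module.Flat.rTensor_preserves_injective_linearMap (M := A)
    (IsScalarTower.toAlgHom R (FunctionRing R A) (FunctionField R A)).toLinearMap
    (IsFractionRing.injective _ _)

variable [Module.Finite R A] [Module.Projective R A]

theorem isIntegral_universalElement : IsIntegral (FunctionRing R A) (universalElement R A) :=
  .of_finite _ _

theorem toGeneric_universalElement :
    toGeneric R A (universalElement R A) = genericElement R A := rfl

theorem aeval_genericElement_map (p : (FunctionRing R A)[X]) :
    aeval (genericElement R A) (p.map (algebraMap _ (FunctionField R A))) =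
      toGeneric R A (aeval (universalElement R A) p) := by
  rw [aeval_map_algebraMap, ← toGeneric_universalElement, aeval_algHom_apply]

theorem aeval_genericElement_map_eq_zero_iff (p : (FunctionRing R A)[X]) :
    aeval (genericElement R A) (p.map (algebraMap _ (FunctionField R A))) = 0 ↔
      aeval (universalElement R A) p = 0 := by
  rw [aeval_genericElement_map, map_eq_zero_iff _ (toGeneric_injective R A)]

variable [IsDomain R]

/-- Over a normal domain the minimal polynomial over the function field has its coefficients in
the function ring, by Gauss's lemma, and is the minimal polynomial over the function ring. -/
theorem map_minpoly_universalElement [IsIntegrallyClosed R] :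
    (minpoly (FunctionRing R A) (universalElement R A)).map
        (algebraMap (FunctionRing R A) (FunctionField R A)) =
      minpoly (FunctionField R A) (genericElement R A) := by
  have : IsIntegrallyClosed (FunctionRing R A) := isIntegrallyClosed_symmetricAlgebra
  have hint := isIntegral_universalElement R A
  have hP := minpoly.monic hint
  have hintK : IsIntegral (FunctionField R A) (genericElement R A) := .of_finite _ _
  have hdvd := minpoly.dvd (FunctionField R A) (genericElement R A)
    ((aeval_genericElement_map_eq_zero_iff R A _).mpr (minpoly.aeval _ (universalElement R A)))
  obtain ⟨Q, hQ⟩ := IsIntegrallyClosed.eq_map_mul_C_of_dvd (FunctionField R A) hP hdvd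
  rw [(minpoly.monic hintK).leadingCoeff, C_1, mul_one] at hQ
  have hinj := IsFractionRing.injective (FunctionRing R A) (FunctionField R A)
  have hQm : Q.Monic := monic_of_injective hinj (hQ ▸ minpoly.monic hintK)
  have hQ0 : aeval (universalElement R A) Q = 0 := by
    rw [← aeval_genericElement_map_eq_zero_iff, hQ, minpoly.aeval]
  rw [← hQ, minpoly.unique' _ _ hQm hQ0 fun q hq => ?_]
  rw [or_iff_not_imp_left]
  intro hq0 hq1
  have := minpoly.degree_le_of_ne_zero (FunctionField R A) (genericElement R A)
    ((Polynomial.map_ne_zero_iff hinj).mpr hq0)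
    ((aeval_genericElement_map_eq_zero_iff R A q).mpr hq1)
  rw [← hQ, degree_map_eq_of_injective hinj, degree_map_eq_of_injective hinj] at this
  exact this.not_gt hq

theorem eq_zero_of_degree_lt_minpoly [IsIntegrallyClosed R] (q : (FunctionRing R A)[X])
    (hq : q.degree < (minpoly (FunctionRing R A) (universalElement R A)).degree)
    (h : aeval (universalElement R A) q = 0) : q = 0 := by
  by_contra hq0
  have hinj := IsFractionRing.injective (FunctionRing R A) (FunctionField R A)
  have := minpoly.degree_le_of_ne_zero (FunctionField R A) (genericElement R A)
    ((Polynomial.map_ne_zero_iff hinj).mpr hq0)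
    ((aeval_genericElement_map_eq_zero_iff R A q).mpr h)
  rw [← map_minpoly_universalElement, degree_map_eq_of_injective hinj,
    degree_map_eq_of_injective hinj] at this
  exact this.not_gt hq

theorem algDegree_eq_natDegree_minpoly [IsIntegrallyClosed R] :
    algDegree R A = (minpoly (FunctionRing R A) (universalElement R A)).natDegree := by
  set P := minpoly (FunctionRing R A) (universalElement R A) with hPdef
  have hP : P.Monic := minpoly.monic (isIntegral_universalElement R A)
  refine le_antisymm (algDegree_le_natDegree P hP.ne_zero (minpoly.aeval _ _)) ?_
  refine le_csInf ?_ fun d hd => ?_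
  · refine ⟨P.natDegree, ?_⟩
    have := isTorsionFree_exteriorPower (S := FunctionRing R A) (M := FunctionRing R A ⊗[R] A)
      (P.natDegree + 1)
    refine AlternatingMap.map_linearDependent _ _ fun hli => ?_
    rw [Fintype.linearIndependent_iff] at hli
    have h0 := hli (fun i => P.coeff i) (by
      rw [← minpoly.aeval (FunctionRing R A) (universalElement R A), ← hPdef,
        aeval_eq_sum_range, Finset.sum_range]) (Fin.last _)
    simp [hP.coeff_natDegree] at h0
  · rw [← hP.natDegree_map (algebraMap _ (FunctionField R A)), map_minpoly_universalElement]
    exact natDegree_minpoly_le_of_ιMulti_pow_eq_zero (K := FunctionField R A) (toGeneric R A) (universalElement R A) hd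

end Generic

end AlgDet

end
open AlgDet in
theorem proposition3p4 (R : Type u) (A : Type v) [CommRing R] [IsDomain R] [IsIntegrallyClosed R]
    [Ring A] [Algebra R A] [Module.Finite R A] [Module.Projective R A]
    (n : ℕ) (hn : ∀ p : PrimeSpectrum R, Module.rankAtStalk (R := R) A p = n)
    (hirr : Irreducible (det R A)) :
    det R A ∈ homogeneousPart R A (algDegree R A) ∧
    algDegree R A ∣ n ∧
    ∃ m : ℕ, cayleyHamilton R A =
      minpoly (FunctionField R A) (genericElement R A) ^ m := by
  have : IsIntegrallyClosed (FunctionRing R A) := isIntegrallyClosed_symmetricAlgebra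
  have hd := algDegree_eq_natDegree_minpoly R A
  have hmap := map_minpoly_universalElement R A
  set P := minpoly (FunctionRing R A) (universalElement R A) with hPdef
  have hP : P.Monic := minpoly.monic (isIntegral_universalElement R A)
  have hscale := scalePoly_eq_of_minimal hP (minpoly.aeval _ _) (eq_zero_of_degree_lt_minpoly R A)
  have hdet : det R A = (-1) ^ algDegree R A * P.coeff 0 := rfl
  have hirr0 : Irreducible (P.coeff 0) := by
    rwa [hdet, irreducible_isUnit_mul (isUnit_one.neg.pow _)] at hirr
  have hirrP := irreducible_of_irreducible_coeff_zero hP hscale hirr0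
  have hirrK : Irreducible (minpoly (FunctionField R A) (genericElement R A)) := by
    rw [← hmap]
    exact (hP.irreducible_iff_irreducible_map_fraction_map (K := FunctionField R A)).mp hirrP
  have hmem : det R A ∈ homogeneousPart R A (algDegree R A) := by
    apply mem_range_pow_of_scale_eq
    rw [hdet, map_mul, map_pow, map_neg, map_one, scale_coeff_zero_of_scalePoly_eq hscale, ← hd]
    simp only [map_mul, map_pow, map_neg, map_one]
    ring
  obtain ⟨m, hm, hrank⟩ := exists_charpoly_mulLeft_eq_minpoly_pow (K := FunctionField R A)
    (genericElement R A) hirrK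
  refine ⟨hmem, ⟨m, ?_⟩, m, hm⟩
  rw [← hmap, hP.natDegree_map, ← hd, mul_comm] at hrank
  exact (finrank_tensorProduct_of_rankAtStalk_eq (K := FunctionField R A) n hn).symm.trans hrank
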